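/- **Setting.** Let $f:\mathbb R^n\to\mathbb R$ be twice continuously differentiable with $\|\nabla^2 f(y)-\nabla^2 f(x)\|\le L\|y-x\|$ for all $x,y\in\mathbb R^n$ (spectral norm, $L\ge 0$). Let $\psi:\mathbb R^n\to\mathbb R\cup\{+\infty\}$ be proper, closed and convex, with domain $Q$ having non-empty interior, and twice differentiable on $Q$ (relative to $Q$ at boundary points of $Q$, if $Q$ contains any). Let $F=f+\psi$ be bounded below on $Q$, $F^\star=\inf_Q F$, and $\xi(y)=\max\{-\lambda_{\min}(\nabla^2F(y)),0\}$ for $y\in Q$. Fix $x_0\in Q$, $\tau_0>0$, $\epsilon>0$ and an integer $m\ge1$. **Inner procedure** $\mathtt{CubicSteps}(x,B,\sigma,m,\epsilon)$ (with the second-order condition, without the stopping test on the gradient norm). Put $x(0)=x$. For $t=0,1,\dots,m-1$ choose any $x(t+1)\in Q$ and $\psi'(x(t+1))\in\partial\psi(x(t+1))$ such that, with $$M_t(y)=f(x(t))+\langle\nabla f(x(t)),y-x(t)\rangle+\tfrac12\langle B(y-x(t)),y-x(t)\rangle+\tfrac\sigma6\|y-x(t)\|^3,$$ one has $$M_t(x(t+1))+\psi(x(t+1))\le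 F(x(t)),\qquad \|\nabla M_t(x(t+1))+\psi'(x(t+1))\|\le\tfrac\sigma4\|x(t+1)-x(t)\|^2,$$ $$B+\sigma\|x(t+1)-x(t)\|I+\nabla^2\psi(x(t+1))\succeq0.$$ If $F(x(0))-F(x(t+1))<\frac{\epsilon^{3/2}}{384\,\sigma^{1/2}}(t+1)$, stop and return $(x(t+1),\mathtt{halt})$. If this does not happen for any $t<m$, return $(x(m),\mathtt{success})$. **Method.** At iteration $k=0,1,2,\dots$, for $\ell=0,1,2,\dots$ let $$\sigma_{k,\ell}=2^4\left(\tfrac23\right)^{1/3}(2^\ell\tau_k)\,m,\qquad h_{k,\ell}=\left[\frac{3\,\sigma_{k,\ell}^{3/2}\epsilon^{3/2}}{2^7\cdot192\; n^{3/2}(2^\ell\tau_k)^3}\right]^{1/3},$$ let $A_{k,\ell}$ be the matrix with columns $\big(\nabla f(x_k+h_{k,\ell}e_j)-\nabla f(x_k)\big)/h_{k,\ell}$, $1\le j\le n$, let $B_{k,\ell}=\frac12(A_{k,\ell}+A_{k,\ell}^\top)$, and run $\mathtt{CubicSteps}(x_k,B_{k,\ell},\sigma_{k,\ell},m,\epsilon)$,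 whose generated iterates are denoted $x_{k,\ell}(t)$, $0\le t\le m$ (up to the halting index if it halts). If the status is $\mathtt{halt}$, increase $\ell$ by one and repeat. If it is $\mathtt{success}$, set $\ell_k=\ell$, let $x_{k+1}$ be the returned point, put $\tau_{k+1}=\max\{\tau_0,2^{\ell_k-1}\tau_k\}$, and go to iteration $k+1$. For $t\ge1$, $\psi'(x_{k,\ell}(t))$ denotes the subgradient chosen together with $x_{k,\ell}(t)$; for $t=0$ it is any element of $\partial\psi(x_k)$. (If $Q$ is open, $\psi'=\nabla\psi$.) One *function and gradient evaluation* is a call of the first-order oracle, which returns both $f(y)$ and $\nabla f(y)$ at one point $y$. Let $\mathrm{FO}_T$ be the number of evaluations during the first $T$ iterations $k=0,\dots,T-1$, with no value reused: one per iteration, and for every run of the inner procedure $n+1$ for the finite differences plus one for each generated iterate $x_{k,\ell}(0),x_{k,\ell}(1),\dots$. **Theorem** (Hessian-free CNM, second-order stationarity). For every execution of the method there is a first iteration index $T=T(\epsilon)<\infty$ such that $$\max\left\{\big\|\nabla f(x_{T,\ell}(t))+\psi'(x_{T,\ell}(t))\big\|,\ \frac{\big[\xi(x_{T,\ell}(t))\big]^2}{2^2\,3^3\,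 m\,\max\{\tau_0,L\}}\right\}\le\epsilon$$ for some executed $\ell\ge0$ and some generated iterate $x_{T,\ell}(t)$, $t\in\{0,\dots,m\}$, and it satisfies $$T(\epsilon)\le\frac{384\cdot2^{5/2}\left(\frac23\right)^{1/6}\max\{\tau_0,L\}^{1/2}\,(F(x_0)-F^\star)}{\sqrt m}\,\epsilon^{-3/2},$$ $$\mathrm{FO}_{T(\epsilon)}\le\frac{5+2(n+m)}{\sqrt m}\,384\cdot2^{5/2}\left(\tfrac23\right)^{1/6}\max\{\tau_0,L\}^{1/2}(F(x_0)-F^\star)\,\epsilon^{-3/2}+[2+n+m]\log_2\frac{\max\{\tau_0,L\}}{\tau_0}.$$ -/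

import Mathlib

namespace CNM

noncomputable section

/-- The space of decision variables, with its Euclidean norm. -/
abbrev Vec (n : ℕ) : Type := EuclideanSpace ℝ (Fin n)

/-! ### The composite part -/

/-- `ψ : ℝⁿ → ℝ ∪ {+∞}` is proper, closed (lower semicontinuous) and convex (convex epigraph). -/
structure ProperClosedConvex {n : ℕ} (ψ : Vec n → EReal) : Prop where
  ne_bot : ∀ x, ψ x ≠ ⊥
  proper : ∃ x, ψ x ≠ ⊤
  closed : LowerSemicontinuous ψ
  convex : Convex ℝ {p : Vec n × ℝ | ψ p.1 ≤ (p.2 : EReal)}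

/-- The effective domain `Q = dom ψ`. -/
def dom {n : ℕ} (ψ : Vec n → EReal) : Set (Vec n) := {x | ψ x ≠ ⊤}

/-- The real value of `ψ`; it is used at points of `dom ψ` only. -/
def val {n : ℕ} (ψ : Vec n → EReal) (x : Vec n) : ℝ := (ψ x).toReal

/-- The convex subdifferential `∂ψ(x)`. -/
def subdifferential {n : ℕ} (ψ : Vec n → EReal) (x : Vec n) : Set (Vec n) :=
  {s | ∀ y, ψ x + ((inner ℝ s (y - x) : ℝ) : EReal) ≤ ψ y}

/-- The objective `F = f + ψ` at points of `dom ψ`. -/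
def objective {n : ℕ} (f : Vec n → ℝ) (ψ : Vec n → EReal) (x : Vec n) : ℝ := f x + val ψ x

/-- The optimal value `F⋆ = inf_{x ∈ dom ψ} F(x)`. -/
def optimalValue {n : ℕ} (f : Vec n → ℝ) (ψ : Vec n → EReal) : ℝ :=
  sInf (objective f ψ '' dom ψ)

/-- The Hessian of `φ` relative to `Q`, as a bilinear form: the second derivative within `Q`.
At interior points of `Q` this is the ordinary Hessian. -/
def hessianOn {n : ℕ} (φ : Vec n → ℝ) (Q : Set (Vec n)) (x : Vec n) :
    Vec n →L[ℝ] Vec n →L[ℝ] ℝ :=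
  fderivWithin ℝ (fderivWithin ℝ φ Q) Q x

/-- `ψ` is twice differentiable on its domain. The domain is convex; it has to have an interior
point for derivatives to be determined. -/
structure TwiceDifferentiable {n : ℕ} (ψ : Vec n → EReal) : Prop where
  interior_nonempty : (interior (dom ψ)).Nonempty
  diff : DifferentiableOn ℝ (val ψ) (dom ψ)
  diff_deriv : DifferentiableOn ℝ (fderivWithin ℝ (val ψ) (dom ψ)) (dom ψ)

/-- The smallest eigenvalue of a (symmetric) bilinear form on `ℝⁿ`. -/
def lambdaMin {n : ℕ} (H : Vec n →L[ℝ] Vec n →L[ℝ] ℝ) : ℝ :=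
  sInf {μ : ℝ | ∃ v : Vec n, v ≠ 0 ∧ ∀ w, H v w = μ * inner ℝ v w}

/-- `ξ(y) = max {-λ_min(∇²F(y)), 0}`. -/
def xi {n : ℕ} (f : Vec n → ℝ) (ψ : Vec n → EReal) (y : Vec n) : ℝ :=
  max (-lambdaMin (hessianOn (objective f ψ) (dom ψ) y)) 0

/-- The Hessian of `f` is Lipschitz continuous with constant `L` in the operator norm. -/
def LipschitzHessian {n : ℕ} (f : Vec n → ℝ) (L : ℝ) : Prop :=
  ∀ x y : Vec n, ‖fderiv ℝ (fderiv ℝ f) y - fderiv ℝ (fderiv ℝ f) x‖ ≤ L * ‖y - x‖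

/-! ### The inner procedure -/

/-- The action of a matrix on a vector of `ℝⁿ`. -/
def act {n : ℕ} (B : Matrix (Fin n) (Fin n) ℝ) (v : Vec n) : Vec n :=
  Matrix.toEuclideanCLM (n := Fin n) (𝕜 := ℝ) B v

/-- The symmetrised forward-difference approximation `B = (A + Aᵀ) / 2` of the Hessian, where the
`j`-th column of `A` is `(∇f(x + h e_j) - ∇f(x)) / h`. -/
def fdHessian {n : ℕ} (f : Vec n → ℝ) (x : Vec n) (h : ℝ) : Matrix (Fin n) (Fin n) ℝ :=
  let A : Matrix (Fin n) (Fin n) ℝ := Matrix.of fun i j =>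
    (gradient f (x + h • EuclideanSpace.single j (1 : ℝ)) i - gradient f x i) / h
  (1 / 2 : ℝ) • (A + A.transpose)

/-- The cubically regularised model `M_{x,σ}(y)` with the exact gradient and the matrix `B`. -/
def cubicModel {n : ℕ} (f : Vec n → ℝ) (B : Matrix (Fin n) (Fin n) ℝ) (σ : ℝ) (x y : Vec n) : ℝ :=
  f x + inner ℝ (gradient f x) (y - x) + (1 / 2) * inner ℝ (act B (y - x)) (y - x)
    + σ / 6 * ‖y - x‖ ^ 3

/-- `x'` is an admissible inexact solution of the subproblem `min_{y ∈ Q} M_{x,σ}(y) + ψ(y)`,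
certified by the subgradient `s = ψ'(x') ∈ ∂ψ(x')`, including the second-order condition
`B + σ ‖x' - x‖ I + ∇²ψ(x') ⪰ 0`. -/
structure InexactCubicStep {n : ℕ} (f : Vec n → ℝ) (ψ : Vec n → EReal)
    (B : Matrix (Fin n) (Fin n) ℝ) (σ : ℝ) (x x' s : Vec n) : Prop where
  mem : x' ∈ dom ψ
  subgrad : s ∈ subdifferential ψ x'
  decrease : cubicModel f B σ x x' + val ψ x' ≤ objective f ψ x
  stationarity : ‖gradient (cubicModel f B σ x) x' + s‖ ≤ σ / 4 * ‖x' - x‖ ^ 2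
  curvature : ∀ v : Vec n,
    0 ≤ inner ℝ (act B v) v + σ * ‖x' - x‖ * ‖v‖ ^ 2 + hessianOn (val ψ) (dom ψ) x' v v

/-- The status returned by the inner procedure when it is run without its stopping test on the
gradient norm. -/
inductive Status : Type
  | success : Status
  | halt : Status

/-- The progress test made after the step from `y t` to `y (t + 1)`. -/
def Progress {n : ℕ} (f : Vec n → ℝ) (ψ : Vec n → EReal) (σ ε : ℝ) (y : ℕ → Vec n) (t : ℕ) :
    Prop :=
  ε ^ (3 / 2 : ℝ) / (384 * σ ^ (1 / 2 : ℝ)) * ((t : ℝ) + 1)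
    ≤ objective f ψ (y 0) - objective f ψ (y (t + 1))

/-- An execution of `CubicSteps(x, B, σ, m, ε)` with the second-order condition on the steps and
without the stopping test on the gradient norm. It generates the iterates `y 0 = x, …, y N`, carries
out the progress test after each step, and stops at the first failure (`halt`) or after `m` successful
tests (`success`); it returns `y N` and `α`. For `1 ≤ t ≤ N` the vector `s t` is the subgradient
`ψ'(y t)` found with `y t`, and `s 0` is any subgradient of `ψ` at the starting point. -/
structure CubicSteps {n : ℕ} (f : Vec n → ℝ) (ψ : Vec n → EReal) (x : Vec n)
    (B : Matrix (Fin n) (Fin n) ℝ) (σ : ℝ) (m : ℕ) (ε : ℝ)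
    (y s : ℕ → Vec n) (N : ℕ) (α : Status) : Prop where
  start : y 0 = x
  start_subgrad : s 0 ∈ subdifferential ψ x
  one_le : 1 ≤ N
  le_m : N ≤ m
  step : ∀ t, t < N → InexactCubicStep f ψ B σ (y t) (y (t + 1)) (s (t + 1))
  continued : ∀ t, t + 1 < N → Progress f ψ σ ε y t
  finished : (α = Status.success ∧ N = m ∧ Progress f ψ σ ε y (N - 1)) ∨
    (α = Status.halt ∧ ¬ Progress f ψ σ ε y (N - 1))

/-! ### The outer method -/

/-- `σ_{k,ℓ} = 2⁴ (2/3)^{1/3} (2^ℓ τ_k) m`. -/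
def sigmaParam (m : ℕ) (τ : ℝ) (l : ℕ) : ℝ :=
  2 ^ 4 * (2 / 3 : ℝ) ^ (1 / 3 : ℝ) * (2 ^ l * τ) * m

/-- `h_{k,ℓ} = [3 σ^{3/2} ε^{3/2} / (2⁷ · 192 · n^{3/2} (2^ℓ τ_k)³)]^{1/3}`. -/
def hParam (n m : ℕ) (ε τ : ℝ) (l : ℕ) : ℝ :=
  (3 * sigmaParam m τ l ^ (3 / 2 : ℝ) * ε ^ (3 / 2 : ℝ) /
    (2 ^ 7 * 192 * (n : ℝ) ^ (3 / 2 : ℝ) * (2 ^ l * τ) ^ 3)) ^ (1 / 3 : ℝ)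

/-- The record of an execution of the method: `x k`, `τ k` are the values at the start of iteration
`k`; `y k l t`, `s k l t` for `t ≤ N k l` are the iterates and subgradients of the `l`-th call of the
inner procedure at iteration `k`, and `α k l` is the status returned by it. Entries that belong to
calls or iterations that are never executed carry no information. -/
structure Trace (n : ℕ) where
  x : ℕ → Vec n
  τ : ℕ → ℝ
  y : ℕ → ℕ → ℕ → Vec n
  s : ℕ → ℕ → ℕ → Vec n
  N : ℕ → ℕ → ℕ
  α : ℕ → ℕ → Status

/-- The `l`-th call of the inner procedure at iteration `k` is executed: every earlier iteration ended
with a success, and the earlier calls of iteration `k` all halted. -/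
def Trace.Executed {n : ℕ} (R : Trace n) (k l : ℕ) : Prop :=
  (∀ j, j < k → ∃ i, R.α j i = Status.success) ∧ ∀ i, i < l → R.α k i = Status.halt

/-- The record `R` is a complete execution of the First-Order CNM from `x₀` with parameters
`τ₀, ε, m`. In this mode the method has no stopping rule of its own; its adaptive search over `l` at
some iteration is allowed to go on forever. -/
structure FirstOrderCNM {n : ℕ} (f : Vec n → ℝ) (ψ : Vec n → EReal) (x₀ : Vec n) (τ₀ ε : ℝ) (m : ℕ)
    (R : Trace n) : Prop where
  x_zero : R.x 0 = x₀
  τ_zero : R.τ 0 = τ₀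
  call : ∀ k l, R.Executed k l →
    CubicSteps f ψ (R.x k) (fdHessian f (R.x k) (hParam n m ε (R.τ k) l)) (sigmaParam m (R.τ k) l)
      m ε (R.y k l) (R.s k l) (R.N k l) (R.α k l)
  x_succ : ∀ k l, R.Executed k l → R.α k l = Status.success → R.x (k + 1) = R.y k l (R.N k l)
  τ_succ : ∀ k l, R.Executed k l → R.α k l = Status.success →
    R.τ (k + 1) = max τ₀ ((2 : ℝ) ^ ((l : ℤ) - 1) * R.τ k)

/-- `ℓ_k`, the index of the successful call of iteration `k` (used for completed iterations). -/
def Trace.lastCall {n : ℕ} (R : Trace n) (k : ℕ) : ℕ := sInf {l | R.α k l = Status.success}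

/-- The number of first-order oracle calls (one call returns `f` and `∇f` at one point) made during
the first `T` iterations, all assumed completed: one call per iteration, and for every call of the inner
procedure `n + 1` calls for the finite differences and one for each of the iterates
`y 0, …, y N`. No value is reused. -/
def Trace.oracleCalls {n : ℕ} (R : Trace n) (T : ℕ) : ℕ :=
  ∑ k ∈ Finset.range T,
    (1 + ∑ l ∈ Finset.range (R.lastCall k + 1), ((n + 1) + (R.N k l + 1)))

/-- At iteration `k` some executed call of the inner procedure generates an iterate `y` such that
`max {‖∇f(y) + ψ'(y)‖, ξ(y)² / (2² 3³ m max {τ₀, L})} ≤ ε`. -/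
def SecondOrderFound {n : ℕ} (f : Vec n → ℝ) (ψ : Vec n → EReal) (L τ₀ ε : ℝ) (m : ℕ) (R : Trace n)
    (k : ℕ) : Prop :=
  ∃ l t : ℕ, R.Executed k l ∧ t ≤ R.N k l ∧
    max ‖gradient f (R.y k l t) + R.s k l t‖
      (1 / (2 ^ 2 * 3 ^ 3 * (m : ℝ) * max τ₀ L) * xi f ψ (R.y k l t) ^ 2) ≤ ε

end

end CNM

namespace CNM

/-! ### Taylor bounds -/

/-! Within one run the matrix `B` stays fixed, so at the `i`-th iterate it misses the true Hessian
by at most `δ + L * D i`, where `δ` is the finite-difference error at the start and `D i` is the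
length of the path travelled so far. Let `r` be the step length, `p` this error divided by `σ`, and
`q = √(ε / σ)`. If the new iterate is not second-order stationary, the bounds on gradient and
curvature force `q ≤ r + p` (`sqrt_div_le_of_not_stationary`), and the step decreases the objective
by at least `σ * (q ^ 3 / 192 + r ^ 3 / 24 - 128 / 3 * p ^ 3)` (`cubic_decrease_bound`).

The loss in `p` is repaid only after summation over the run: `sum_pow_three_partial_sum_le` bounds
the cubed path lengths by the cubed steps, which the terms `r ^ 3 / 24` absorb because `σ ≥ 12 * L *
m`. The choice of `h` keeps the finite-difference loss within half of the `q ^ 3` terms. What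
remains is exactly the progress threshold (`CubicSteps.progress`).

So, until a stationary iterate appears, a call can halt only while `2 ^ l * τ k < L`. Hence `2 ^ l *
τ k ≤ 2 * max τ₀ L` on every executed call, each search over `l` ends, and each iteration lowers the
objective by a fixed multiple of `√m * ε ^ (3 / 2)`. Boundedness below limits the number of
iterations; the total number of calls follows by telescoping `log₂ τ`. -/

/-- Integrating the derivative bound over `[0, 1]`. It is used along segments, with `p = 1` for the
gradient and `p = 2` for the value. -/
theorem norm_image_one_le_of_deriv_le_pow {E : Type*} [NormedAddCommGroup E] [NormedSpace ℝ E]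
    {g g' : ℝ → E} {K : ℝ} {p : ℕ} (h0 : g 0 = 0) (hg : ∀ t, HasDerivAt g (g' t) t)
    (hb : ∀ t, 0 ≤ t → ‖g' t‖ ≤ K * t ^ p) : ‖g 1‖ ≤ K / (p + 1) := by
  have hp : (p : ℝ) + 1 ≠ 0 := by positivity
  have h := image_norm_le_of_norm_deriv_right_le_deriv_boundary (a := (0 : ℝ)) (b := 1)
    (f := g) (f' := g') (B := fun t => K / (p + 1) * t ^ (p + 1)) (B' := fun t => K * t ^ p)
    (fun t _ => (hg t).continuousAt.continuousWithinAt)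
    (fun t _ => (hg t).hasDerivWithinAt) (by simp [h0])
    (fun t => by
      refine ((hasDerivAt_pow (p + 1) t).const_mul (K / (p + 1))).congr_deriv ?_
      rw [Nat.add_sub_cancel]
      push_cast
      field_simp)
    (fun t ht => hb t ht.1) (x := 1) (by simp)
  simpa using h

section Taylor

variable {n : ℕ} {f : Vec n → ℝ} {L : ℝ}

theorem hasFDerivAt_fderiv (hf : ContDiff ℝ 2 f) (x : Vec n) :
    HasFDerivAt (fderiv ℝ f) (fderiv ℝ (fderiv ℝ f) x) x :=
  ((hf.fderiv_right (m := 1) (by norm_num)).differentiable (by norm_num) x).hasFDerivAt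

theorem hasDerivAt_line (x v : Vec n) (t : ℝ) : HasDerivAt (fun t : ℝ => x + t • v) v t := by
  simpa using ((hasDerivAt_id t).smul_const v).const_add x

theorem hasDerivAt_fderiv_line (hf : ContDiff ℝ 2 f) (x v w : Vec n) (t : ℝ) :
    HasDerivAt (fun t : ℝ => fderiv ℝ f (x + t • v) w)
      (fderiv ℝ (fderiv ℝ f) (x + t • v) v w) t := by
  have h := (hasFDerivAt_fderiv hf (x + t • v)).comp_hasDerivAt t (hasDerivAt_line x v t)
  simpa using h.clm_apply (hasDerivAt_const t w)

theorem LipschitzHessian.abs_apply_sub_le (hA : LipschitzHessian f L) (x y v w : Vec n) :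
    |fderiv ℝ (fderiv ℝ f) y v w - fderiv ℝ (fderiv ℝ f) x v w| ≤ L * ‖y - x‖ * ‖v‖ * ‖w‖ := by
  have h := (fderiv ℝ (fderiv ℝ f) y - fderiv ℝ (fderiv ℝ f) x).le_opNorm₂ v w
  rw [Real.norm_eq_abs] at h
  simp only [sub_apply] at h
  refine h.trans ?_
  gcongr
  exact hA x y

theorem LipschitzHessian.abs_fderiv_sub_le (hf : ContDiff ℝ 2 f) (hA : LipschitzHessian f L)
    (x v w : Vec n) :
    |fderiv ℝ f (x + v) w - fderiv ℝ f x w - fderiv ℝ (fderiv ℝ f) x v w|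
      ≤ L / 2 * ‖v‖ ^ 2 * ‖w‖ := by
  have h := norm_image_one_le_of_deriv_le_pow (p := 1) (K := L * ‖v‖ ^ 2 * ‖w‖)
    (g := fun t : ℝ => fderiv ℝ f (x + t • v) w - fderiv ℝ f x w
      - t * fderiv ℝ (fderiv ℝ f) x v w)
    (g' := fun t : ℝ => fderiv ℝ (fderiv ℝ f) (x + t • v) v w - fderiv ℝ (fderiv ℝ f) x v w)
    (by simp)
    (fun t => by
      refine (((hasDerivAt_fderiv_line hf x v w t).sub_const (fderiv ℝ f x w)).sub
        ((hasDerivAt_id t).mul_const (fderiv ℝ (fderiv ℝ f) x v w))).congr_deriv ?_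
      simp)
    (fun t ht => by
      have := hA.abs_apply_sub_le x (x + t • v) v w
      rw [add_sub_cancel_left, norm_smul, Real.norm_of_nonneg ht] at this
      rw [Real.norm_eq_abs]
      linarith)
  rw [Real.norm_eq_abs] at h
  simp only [one_smul, one_mul, Nat.cast_one] at h
  linarith

theorem LipschitzHessian.abs_value_sub_le (hf : ContDiff ℝ 2 f) (hA : LipschitzHessian f L)
    (x v : Vec n) :
    |f (x + v) - f x - fderiv ℝ f x v - 1 / 2 * fderiv ℝ (fderiv ℝ f) x v v|
      ≤ L / 6 * ‖v‖ ^ 3 := by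
  have h := norm_image_one_le_of_deriv_le_pow (p := 2) (K := L / 2 * ‖v‖ ^ 3)
    (g := fun t : ℝ => f (x + t • v) - f x - t * fderiv ℝ f x v
      - t ^ 2 * (1 / 2 * fderiv ℝ (fderiv ℝ f) x v v))
    (g' := fun t : ℝ => fderiv ℝ f (x + t • v) v - fderiv ℝ f x v
      - t * fderiv ℝ (fderiv ℝ f) x v v)
    (by simp)
    (fun t => by
      have h1 := ((hf.differentiable (by norm_num)) (x + t • v)).hasFDerivAt.comp_hasDerivAt t
        (hasDerivAt_line x v t)
      have h2 := ((h1.sub_const (f x)).sub ((hasDerivAt_id t).mul_const (fderiv ℝ f x v))).sub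
        ((hasDerivAt_pow 2 t).mul_const (1 / 2 * fderiv ℝ (fderiv ℝ f) x v v))
      refine h2.congr_deriv ?_
      norm_num
      ring)
    (fun t ht => by
      have := hA.abs_fderiv_sub_le hf x (t • v) v
      rw [norm_smul, Real.norm_of_nonneg ht] at this
      simp only [map_smul, smul_apply, smul_eq_mul] at this
      rw [Real.norm_eq_abs]
      linarith)
  rw [Real.norm_eq_abs] at h
  simp only [one_smul, one_mul, one_pow, Nat.cast_ofNat] at h
  linarith

theorem snd_fderiv_symm (hf : ContDiff ℝ 2 f) (x v w : Vec n) :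
    fderiv ℝ (fderiv ℝ f) x v w = fderiv ℝ (fderiv ℝ f) x w v :=
  (hf.contDiffAt.isSymmSndFDerivAt (by simp)).eq v w

theorem inner_gradient (f : Vec n → ℝ) (x w : Vec n) :
    inner ℝ (gradient f x) w = fderiv ℝ f x w := by
  simp [gradient]

end Taylor

/-! ### The finite-difference Hessian -/

section FiniteDifference

variable {n : ℕ} {f : Vec n → ℝ} {L : ℝ}

theorem inner_act_eq (A : Matrix (Fin n) (Fin n) ℝ) (v w : Vec n) :
    inner ℝ (act A v) w = ∑ j, v j * ∑ i, A i j * w i := by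
  simp only [act, PiLp.inner_apply, Matrix.ofLp_toEuclideanCLM, Matrix.mulVec, dotProduct,
    RCLike.inner_apply, conj_trivial, Finset.mul_sum]
  rw [Finset.sum_comm]
  refine Finset.sum_congr rfl fun j _ => Finset.sum_congr rfl fun i _ => ?_
  ring

theorem inner_act_transpose (A : Matrix (Fin n) (Fin n) ℝ) (v w : Vec n) :
    inner ℝ (act A.transpose v) w = inner ℝ (act A w) v := by
  rw [inner_act_eq, inner_act_eq]
  simp only [Finset.mul_sum, Matrix.transpose_apply]
  rw [Finset.sum_comm]
  refine Finset.sum_congr rfl fun j _ => Finset.sum_congr rfl fun i _ => ?_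
  ring

theorem inner_act_symmetrization (A : Matrix (Fin n) (Fin n) ℝ) (v w : Vec n) :
    inner ℝ (act ((1 / 2 : ℝ) • (A + A.transpose)) v) w
      = 1 / 2 * (inner ℝ (act A v) w + inner ℝ (act A w) v) := by
  rw [← inner_act_transpose A v w]
  simp [act, inner_add_left, inner_smul_left, mul_add]

theorem inner_act_fdHessian_comm (f : Vec n → ℝ) (x : Vec n) (h : ℝ) (v w : Vec n) :
    inner ℝ (act (fdHessian f x h) v) w = inner ℝ (act (fdHessian f x h) w) v := by
  simp only [fdHessian, inner_act_symmetrization]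
  ring

theorem sum_abs_le_sqrt_mul_norm (v : Vec n) : ∑ j, |v j| ≤ √n * ‖v‖ := by
  rw [EuclideanSpace.norm_eq, ← Real.sqrt_mul (Nat.cast_nonneg n)]
  refine Real.le_sqrt_of_sq_le ?_
  simpa using sq_sum_le_card_mul_sum_sq (s := Finset.univ) (f := fun j => |v j|)

/-- Each column has error at most `L * h / 2` by Taylor; combining columns with weights `v j` costs
the ℓ¹ norm of `v`, hence the factor `√n`. Symmetrising preserves the bound because the true Hessian
is symmetric. -/
theorem abs_inner_act_fdHessian_sub_le (hf : ContDiff ℝ 2 f) (hL : 0 ≤ L)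
    (hA : LipschitzHessian f L) (x : Vec n) {h : ℝ} (hh : 0 < h) (v w : Vec n) :
    |inner ℝ (act (fdHessian f x h) v) w - fderiv ℝ (fderiv ℝ f) x v w|
      ≤ √n * L * h / 2 * ‖v‖ * ‖w‖ := by
  set e : Fin n → Vec n := fun j => EuclideanSpace.single j (1 : ℝ) with he
  set A : Matrix (Fin n) (Fin n) ℝ := Matrix.of fun i j =>
    (gradient f (x + h • EuclideanSpace.single j (1 : ℝ)) i - gradient f x i) / h with hAdef
  have hcol : ∀ (j : Fin n) (w : Vec n),
      |∑ i, A i j * w i - fderiv ℝ (fderiv ℝ f) x (e j) w| ≤ L * h / 2 * ‖w‖ := by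
    intro j w
    have h1 : ∑ i, A i j * w i = (fderiv ℝ f (x + h • e j) w - fderiv ℝ f x w) / h := by
      rw [← inner_gradient, ← inner_gradient, ← inner_sub_left]
      simp only [PiLp.inner_apply, hAdef, Matrix.of_apply, RCLike.inner_apply, conj_trivial,
        PiLp.sub_apply, Finset.sum_div, he]
      refine Finset.sum_congr rfl fun i _ => ?_
      ring
    have h2 := hA.abs_fderiv_sub_le hf x (h • e j) w
    have h3 : ‖h • e j‖ = h := by simp [he, norm_smul, abs_of_pos hh]
    rw [h3] at h2
    simp only [map_smul, smul_apply, smul_eq_mul] at h2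
    have h4 : ∑ i, A i j * w i - fderiv ℝ (fderiv ℝ f) x (e j) w
        = (fderiv ℝ f (x + h • e j) w - fderiv ℝ f x w
          - h * fderiv ℝ (fderiv ℝ f) x (e j) w) / h := by
      rw [h1]; field_simp
    rw [h4, abs_div, abs_of_pos hh, div_le_iff₀ hh]
    linarith
  have hmat : ∀ v w : Vec n, |inner ℝ (act A v) w - fderiv ℝ (fderiv ℝ f) x v w|
      ≤ √n * L * h / 2 * ‖v‖ * ‖w‖ := by
    intro v w
    have hv : v = ∑ j, v j • e j := by
      simpa [he] using ((EuclideanSpace.basisFun (Fin n) ℝ).sum_repr v).symm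
    have h1 : fderiv ℝ (fderiv ℝ f) x v w = ∑ j, v j * fderiv ℝ (fderiv ℝ f) x (e j) w := by
      conv_lhs => rw [hv]
      simp [map_sum, sum_apply]
    rw [inner_act_eq, h1, ← Finset.sum_sub_distrib]
    calc |∑ j, (v j * ∑ i, A i j * w i - v j * fderiv ℝ (fderiv ℝ f) x (e j) w)|
        ≤ ∑ j, |v j * ∑ i, A i j * w i - v j * fderiv ℝ (fderiv ℝ f) x (e j) w| :=
          Finset.abs_sum_le_sum_abs _ _
      _ ≤ ∑ j, |v j| * (L * h / 2 * ‖w‖) := by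
          refine Finset.sum_le_sum fun j _ => ?_
          rw [← mul_sub, abs_mul]
          exact mul_le_mul_of_nonneg_left (hcol j w) (abs_nonneg _)
      _ = (∑ j, |v j|) * (L * h / 2 * ‖w‖) := by rw [Finset.sum_mul]
      _ ≤ (√n * ‖v‖) * (L * h / 2 * ‖w‖) :=
          mul_le_mul_of_nonneg_right (sum_abs_le_sqrt_mul_norm v) (by positivity)
      _ = _ := by ring
  have h1 := abs_le.1 (hmat v w)
  have h2 := abs_le.1 (hmat w v)
  rw [snd_fderiv_symm hf x w v] at h2
  have h3 : inner ℝ (act (fdHessian f x h) v) w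
      = 1 / 2 * (inner ℝ (act A v) w + inner ℝ (act A w) v) := inner_act_symmetrization A v w
  rw [h3, abs_le]
  constructor <;> linarith [h1.1, h1.2, h2.1, h2.2]

end FiniteDifference

/-! ### Estimates for a single inexact cubic step -/

section Step

variable {n : ℕ} {f : Vec n → ℝ} {ψ : Vec n → EReal} {L : ℝ}

theorem ProperClosedConvex.convex_dom (hψ : ProperClosedConvex ψ) : Convex ℝ (dom ψ) := by
  have h : dom ψ = LinearMap.fst ℝ (Vec n) ℝ '' {p : Vec n × ℝ | ψ p.1 ≤ (p.2 : EReal)} := by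
    ext x
    constructor
    · intro hx
      exact ⟨(x, (ψ x).toReal), (EReal.coe_toReal hx (hψ.ne_bot x)).ge, rfl⟩
    · rintro ⟨p, hp, rfl⟩ htop
      exact (EReal.coe_lt_top p.2).not_ge (htop ▸ hp)
  rw [h]
  exact hψ.convex.linear_image _

theorem hessianOn_objective (hf : ContDiff ℝ 2 f) (hψ : ProperClosedConvex ψ)
    (hψ2 : TwiceDifferentiable ψ) {y : Vec n} (hy : y ∈ dom ψ) :
    hessianOn (objective f ψ) (dom ψ) y
      = fderiv ℝ (fderiv ℝ f) y + hessianOn (val ψ) (dom ψ) y := by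
  -- Convexity with non-empty interior makes derivatives within the domain unique, boundary points
  -- included; only then are they additive.
  have hQ : UniqueDiffOn ℝ (dom ψ) :=
    uniqueDiffOn_convex hψ.convex_dom hψ2.interior_nonempty
  have h1 : ∀ z ∈ dom ψ, fderivWithin ℝ (objective f ψ) (dom ψ) z
      = (fderiv ℝ f + fderivWithin ℝ (val ψ) (dom ψ)) z := by
    intro z hz
    exact (((hf.differentiable (by norm_num)) z).hasFDerivAt.hasFDerivWithinAt.add
      (hψ2.diff z hz).hasFDerivWithinAt).fderivWithin (hQ z hz)
  rw [hessianOn, fderivWithin_congr h1 (h1 y hy)]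
  exact ((hasFDerivAt_fderiv hf y).hasFDerivWithinAt.add
    (hψ2.diff_deriv y hy).hasFDerivWithinAt).fderivWithin (hQ y hy)

theorem neg_lambdaMin_le {H : Vec n →L[ℝ] Vec n →L[ℝ] ℝ} {C : ℝ} (hC : 0 ≤ C)
    (hH : ∀ v, 0 ≤ H v v + C * ‖v‖ ^ 2) : -lambdaMin H ≤ C := by
  rw [neg_le]
  have key : ∀ μ ∈ {μ : ℝ | ∃ v : Vec n, v ≠ 0 ∧ ∀ w, H v w = μ * inner ℝ v w}, -C ≤ μ := by
    rintro μ ⟨v, hv, hμ⟩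
    have h1 := hH v
    rw [hμ v, real_inner_self_eq_norm_sq, ← add_mul] at h1
    have h2 : 0 < ‖v‖ ^ 2 := by positivity
    linarith [nonneg_of_mul_nonneg_left h1 h2]
  rcases Set.eq_empty_or_nonempty
    {μ : ℝ | ∃ v : Vec n, v ≠ 0 ∧ ∀ w, H v w = μ * inner ℝ v w} with h | h
  -- `H` is not assumed symmetric and `n` may be `0`, so there may be no eigenvalue; then `sInf ∅ =
  -- 0` and `0 ≤ C` suffices.
  · rw [lambdaMin, h, Real.sInf_empty]
    linarith
  · exact le_csInf h key

theorem inner_gradient_cubicModel (f : Vec n → ℝ) {B : Matrix (Fin n) (Fin n) ℝ}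
    (hB : ∀ v w, inner ℝ (act B v) w = inner ℝ (act B w) v) (σ : ℝ) (x x' w : Vec n) :
    inner ℝ (gradient (cubicModel f B σ x) x') w
      = fderiv ℝ f x w + inner ℝ (act B (x' - x)) w
        + σ / 2 * ‖x' - x‖ * inner ℝ (x' - x) w := by
  have hd : HasFDerivAt (fun y : Vec n => y - x) (ContinuousLinearMap.id ℝ (Vec n)) x' :=
    (hasFDerivAt_id x').sub_const x
  let T : Vec n →L[ℝ] Vec n := Matrix.toEuclideanCLM (n := Fin n) (𝕜 := ℝ) B
  have h1 := (innerSL ℝ (gradient f x)).hasFDerivAt.comp x' hd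
  have h2 := (HasFDerivAt.inner ℝ (T.hasFDerivAt.comp x' hd) hd).const_mul (1 / 2 : ℝ)
  have h3 := ((hasFDerivAt_norm_rpow (x' - x) (p := 3) (by norm_num)).comp x' hd).const_mul
    (σ / 6 : ℝ)
  have h := ((h1.const_add (f x)).add h2).add h3
  have h4 := h.congr_of_eventuallyEq (f₁ := cubicModel f B σ x)
    (Filter.Eventually.of_forall fun y => by
    simp only [cubicModel, act, Pi.add_apply, Function.comp, innerSL_apply_apply]
    norm_cast)
  rw [inner_gradient, h4.fderiv]
  have h5 := hB w (x' - x)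
  simp only [act] at h5 ⊢
  simp only [add_apply, ContinuousLinearMap.comp_apply, smul_apply, innerSL_apply_apply,
    inner_gradient, ContinuousLinearMap.coe_id', id, fderivInnerCLM_apply,
    ContinuousLinearMap.prod_apply, Function.comp, smul_eq_mul]
  rw [h5, show (3 : ℝ) - 2 = 1 by norm_num, Real.rpow_one]
  ring

variable {B : Matrix (Fin n) (Fin n) ℝ} {σ Δ : ℝ} {x x' s : Vec n}

theorem InexactCubicStep.le_objective_sub (hf : ContDiff ℝ 2 f) (hA : LipschitzHessian f L)
    (hB : ∀ v w, |inner ℝ (act B v) w - fderiv ℝ (fderiv ℝ f) x v w| ≤ Δ * ‖v‖ * ‖w‖)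
    (h : InexactCubicStep f ψ B σ x x' s) :
    (σ - L) / 6 * ‖x' - x‖ ^ 3 - Δ / 2 * ‖x' - x‖ ^ 2 ≤ objective f ψ x - objective f ψ x' := by
  have h1 := abs_le.1 (hA.abs_value_sub_le hf x (x' - x))
  have h2 := abs_le.1 (hB (x' - x) (x' - x))
  have h3 := h.decrease
  rw [add_sub_cancel] at h1
  simp only [cubicModel, inner_gradient] at h3
  simp only [objective] at h3 ⊢
  linarith [h1.2, h2.1]

/-- Pairing `w = gradient f x' + s` with itself avoids vector identities. The coefficient of `‖x' -
x‖ ^ 2` collects `L / 2` from Taylor, `σ / 4` from inexact stationarity and `σ / 2` from the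
gradient of the cubic term. -/
theorem InexactCubicStep.norm_gradient_add_le (hf : ContDiff ℝ 2 f) (hL : 0 ≤ L)
    (hA : LipschitzHessian f L) (hσ : 0 ≤ σ) (hΔ : 0 ≤ Δ)
    (hsymm : ∀ v w, inner ℝ (act B v) w = inner ℝ (act B w) v)
    (hB : ∀ v w, |inner ℝ (act B v) w - fderiv ℝ (fderiv ℝ f) x v w| ≤ Δ * ‖v‖ * ‖w‖)
    (h : InexactCubicStep f ψ B σ x x' s) :
    ‖gradient f x' + s‖ ≤ (L / 2 + 3 / 4 * σ) * ‖x' - x‖ ^ 2 + Δ * ‖x' - x‖ := by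
  set w := gradient f x' + s with hw
  have h1 := abs_le.1 (hA.abs_fderiv_sub_le hf x (x' - x) w)
  have h2 := abs_le.1 (hB (x' - x) w)
  have h3 := real_inner_le_norm (gradient (cubicModel f B σ x) x' + s) w
  have h4 := mul_le_mul_of_nonneg_right h.stationarity (norm_nonneg w)
  have h5 := mul_le_mul_of_nonneg_left (neg_le_of_abs_le (abs_real_inner_le_norm (x' - x) w))
    (show 0 ≤ σ / 2 * ‖x' - x‖ by positivity)
  rw [add_sub_cancel] at h1
  rw [inner_add_left, inner_gradient_cubicModel f hsymm] at h3
  have h6 : ‖w‖ * ‖w‖ = fderiv ℝ f x' w + inner ℝ s w := by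
    rw [← inner_gradient, ← inner_add_left, ← hw, real_inner_self_eq_norm_mul_norm]
  have h7 : ‖w‖ * ‖w‖ ≤ ((L / 2 + 3 / 4 * σ) * ‖x' - x‖ ^ 2 + Δ * ‖x' - x‖) * ‖w‖ := by
    linarith [h1.2, h2.1]
  rcases (norm_nonneg w).eq_or_lt with h0 | h0
  · rw [← h0]
    positivity
  · exact le_of_mul_le_mul_right h7 h0

theorem InexactCubicStep.xi_le (hf : ContDiff ℝ 2 f) (hL : 0 ≤ L) (hA : LipschitzHessian f L)
    (hψ : ProperClosedConvex ψ) (hψ2 : TwiceDifferentiable ψ) (hσ : 0 ≤ σ) (hΔ : 0 ≤ Δ)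
    (hB : ∀ v w, |inner ℝ (act B v) w - fderiv ℝ (fderiv ℝ f) x v w| ≤ Δ * ‖v‖ * ‖w‖)
    (h : InexactCubicStep f ψ B σ x x' s) :
    xi f ψ x' ≤ (σ + L) * ‖x' - x‖ + Δ := by
  have hC : 0 ≤ (σ + L) * ‖x' - x‖ + Δ := by positivity
  refine max_le (neg_lambdaMin_le hC fun v => ?_) hC
  have h1 := abs_le.1 (hA.abs_apply_sub_le x x' v v)
  have h2 := abs_le.1 (hB v v)
  have h3 := h.curvature v
  rw [hessianOn_objective hf hψ hψ2 h.mem]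
  simp only [add_apply]
  linarith [h1.1, h2.2]

end Step

/-! ### Progress of the inner procedure -/

theorem cubic_decrease_bound {σ L r p q : ℝ} (hL : 12 * L ≤ σ) (hσ : 0 < σ) (hr : 0 ≤ r)
    (hp : 0 ≤ p) (hq : 0 ≤ q) (hqrp : q ≤ r + p) :
    σ * (q ^ 3 / 192 + r ^ 3 / 24 - 128 / 3 * p ^ 3)
      ≤ (σ - L) / 6 * r ^ 3 - (σ * p) / 2 * r ^ 2 := by
  have h1 : q ^ 3 ≤ 4 * (r ^ 3 + p ^ 3) := by
    refine (pow_le_pow_left₀ hq hqrp 3).trans ?_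
    nlinarith [mul_nonneg (add_nonneg hr hp) (sq_nonneg (r - p))]
  have hr3 : 0 ≤ r ^ 3 := by positivity
  have hp3 : 0 ≤ p ^ 3 := by positivity
  -- A crude Young inequality: for `6 * p ≤ r` the first term alone suffices, otherwise the second.
  have h2 : p / 2 * r ^ 2 ≤ 1 / 12 * r ^ 3 + 36 * p ^ 3 := by
    rcases le_total (6 * p) r with h | h
    · nlinarith [mul_nonneg (sub_nonneg.2 h) (sq_nonneg r)]
    · have : r ^ 2 ≤ (6 * p) ^ 2 := pow_le_pow_left₀ hr h 2
      nlinarith [mul_le_mul_of_nonneg_left this hp]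
  have h3 : 11 / 12 * σ ≤ σ - L := by linarith
  have h4 : 11 / 12 * σ / 6 * r ^ 3 ≤ (σ - L) / 6 * r ^ 3 := by gcongr
  have h5 : q ^ 3 / 192 + r ^ 3 / 24 - 128 / 3 * p ^ 3 ≤ 11 / 72 * r ^ 3 - p / 2 * r ^ 2 := by
    linarith
  have h6 := mul_le_mul_of_nonneg_left h5 hσ.le
  linarith

/-- The power mean inequality bounds the cube of a partial sum of `k` terms by `k ^ 2` times the sum
of cubes, and `k ^ 3 / 3 + k ^ 2 ≤ (k + 1) ^ 3 / 3` closes the induction. -/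
theorem sum_pow_three_partial_sum_le {r : ℕ → ℝ} (hr : ∀ i, 0 ≤ r i) (k : ℕ) :
    ∑ i ∈ Finset.range k, (∑ j ∈ Finset.range i, r j) ^ 3
      ≤ (k : ℝ) ^ 3 / 3 * ∑ j ∈ Finset.range k, r j ^ 3 := by
  induction k with
  | zero => simp
  | succ k ih =>
    have hS : 0 ≤ ∑ j ∈ Finset.range k, r j ^ 3 :=
      Finset.sum_nonneg fun j _ => pow_nonneg (hr j) 3
    have h1 : (∑ j ∈ Finset.range k, r j) ^ 3 ≤ (k : ℝ) ^ 2 * ∑ j ∈ Finset.range k, r j ^ 3 := by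
      rcases Nat.eq_zero_or_pos k with rfl | hk
      · simp
      · have := pow_sum_div_card_le_sum_pow (s := Finset.range k) (f := r) (fun j _ => hr j) 2
        rw [Finset.card_range, div_le_iff₀ (by positivity), mul_comm] at this
        exact this
    rw [Finset.sum_range_succ, Finset.sum_range_succ (fun j => r j ^ 3)]
    have h2 : 0 ≤ (k + 1 : ℝ) ^ 3 / 3 * r k ^ 3 := by have := hr k; positivity
    have h3 : (k : ℝ) ^ 3 / 3 + (k : ℝ) ^ 2 ≤ (k + 1 : ℝ) ^ 3 / 3 := by
      have : (0 : ℝ) ≤ k := Nat.cast_nonneg k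
      nlinarith
    have h4 := mul_le_mul_of_nonneg_right h3 hS
    push_cast
    linarith

theorem rpow_three_halves {a : ℝ} (ha : 0 ≤ a) : a ^ (3 / 2 : ℝ) = √a ^ 3 := by
  rw [Real.sqrt_eq_rpow, ← Real.rpow_natCast, ← Real.rpow_mul ha]
  norm_num

theorem mul_sqrt_div_pow_three {ε σ : ℝ} (hε : 0 ≤ ε) (hσ : 0 < σ) :
    σ * √(ε / σ) ^ 3 = ε ^ (3 / 2 : ℝ) / σ ^ (1 / 2 : ℝ) := by
  have h1 : 0 < √σ := Real.sqrt_pos.2 hσ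
  rw [rpow_three_halves hε, ← Real.sqrt_eq_rpow, Real.sqrt_div hε]
  nth_rw 1 [← Real.sq_sqrt hσ.le]
  field_simp

section Progress

variable {n m : ℕ} {f : Vec n → ℝ} {ψ : Vec n → EReal} {L P ε σ δ : ℝ}
  {B : Matrix (Fin n) (Fin n) ℝ} {x : Vec n} {y s : ℕ → Vec n} {N : ℕ} {α : Status}

/-- Both measures are controlled by `r + p`: the gradient by `σ * (r + p) ^ 2`, the curvature by `13
/ 12 * σ * (r + p)`. The upper bound on `σ` serves only the second, where it turns the normalisation
by `m * P` into one by `σ`. -/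
theorem sqrt_div_le_of_not_stationary {g ξ r p : ℝ} (hσ : 0 < σ) (hP : 0 < P) (hm : 1 ≤ m)
    (hLσ : 12 * L ≤ σ) (hσP : σ ≤ 32 * m * P) (hr : 0 ≤ r) (hp : 0 ≤ p)
    (hξ : 0 ≤ ξ) (hg : g ≤ (L / 2 + 3 / 4 * σ) * r ^ 2 + (σ * p) * r)
    (hξ' : ξ ≤ (σ + L) * r + σ * p)
    (hnot : ε < max g (1 / (2 ^ 2 * 3 ^ 3 * (m : ℝ) * P) * ξ ^ 2)) : √(ε / σ) ≤ r + p := by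
  refine Real.sqrt_le_iff.2 ⟨by positivity, ?_⟩
  rw [div_le_iff₀ hσ]
  have hrp : 0 ≤ σ * (r * p) := by positivity
  have hpp : 0 ≤ σ * p ^ 2 := by positivity
  rcases lt_max_iff.1 hnot with h | h
  · have h1 : (L / 2 + 3 / 4 * σ) * r ^ 2 ≤ σ * r ^ 2 := by gcongr; linarith
    nlinarith
  · have hm' : (0 : ℝ) < m := by exact_mod_cast hm
    rw [one_div, inv_mul_eq_div, lt_div_iff₀ (by positivity)] at h
    have h1 : ξ ≤ 13 / 12 * σ * (r + p) := by
      have h2 : (σ + L) * r ≤ 13 / 12 * σ * r := by gcongr; linarith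
      have h3 : 0 ≤ σ * p := by positivity
      linarith
    have h2 : ξ ^ 2 ≤ (13 / 12 * σ * (r + p)) ^ 2 := pow_le_pow_left₀ hξ h1 2
    rcases le_or_gt ε 0 with hε | hε
    · exact hε.trans (by positivity)
    · have h3 := mul_le_mul_of_nonneg_left hσP hε.le
      have h4 : σ * ε ≤ σ * ((r + p) ^ 2 * σ) := by
        have h5 : 0 ≤ (σ * (r + p)) ^ 2 := by positivity
        nlinarith
      exact le_of_mul_le_mul_left h4 hσ

theorem CubicSteps.progress (hf : ContDiff ℝ 2 f) (hL : 0 ≤ L) (hA : LipschitzHessian f L)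
    (hψ : ProperClosedConvex ψ) (hψ2 : TwiceDifferentiable ψ) (hε : 0 < ε) (hσ : 0 < σ)
    (hP : 0 < P) (hm : 1 ≤ m) (hLσ : 12 * (L * m) ≤ σ) (hσP : σ ≤ 32 * m * P) (hδ : 0 ≤ δ)
    (hδ' : 65536 * (δ / σ) ^ 3 ≤ √(ε / σ) ^ 3)
    (hsymm : ∀ v w, inner ℝ (act B v) w = inner ℝ (act B w) v)
    (hB : ∀ v w, |inner ℝ (act B v) w - fderiv ℝ (fderiv ℝ f) x v w| ≤ δ * ‖v‖ * ‖w‖)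
    (h : CubicSteps f ψ x B σ m ε y s N α)
    (hnot : ∀ t < N, ε < max ‖gradient f (y (t + 1)) + s (t + 1)‖
      (1 / (2 ^ 2 * 3 ^ 3 * (m : ℝ) * P) * xi f ψ (y (t + 1)) ^ 2))
    {t : ℕ} (ht : t < N) : Progress f ψ σ ε y t := by
  have hm' : (1 : ℝ) ≤ m := by exact_mod_cast hm
  have hLσ' : 12 * L ≤ σ := by nlinarith
  set q := √(ε / σ) with hq
  set r : ℕ → ℝ := fun i => ‖y (i + 1) - y i‖ with hr
  set D : ℕ → ℝ := fun i => ∑ j ∈ Finset.range i, r j with hD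
  have hr0 : ∀ i, 0 ≤ r i := fun i => norm_nonneg _
  have hD0 : ∀ i, 0 ≤ D i := fun i => Finset.sum_nonneg fun j _ => hr0 j
  have hdist : ∀ i, ‖y i - x‖ ≤ D i := by
    intro i
    rw [← h.start, ← Finset.sum_range_sub]
    exact norm_sum_le _ _
  have hstep : ∀ i < N, σ * (q ^ 3 / 192 + r i ^ 3 / 24 - 128 / 3 * ((δ + L * D i) / σ) ^ 3)
      ≤ objective f ψ (y i) - objective f ψ (y (i + 1)) := by
    intro i hi
    have hΔ : 0 ≤ δ + L * D i := by have := hD0 i; positivity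
    -- Lipschitz continuity carries the error bound from `x` to `y i`, at the price of the path
    -- length.
    have hBi : ∀ v w, |inner ℝ (act B v) w - fderiv ℝ (fderiv ℝ f) (y i) v w|
        ≤ (δ + L * D i) * ‖v‖ * ‖w‖ := by
      intro v w
      have h1 := hB v w
      have h2 := hA.abs_apply_sub_le x (y i) v w
      have h3 : L * ‖y i - x‖ * ‖v‖ * ‖w‖ ≤ L * D i * ‖v‖ * ‖w‖ := by
        gcongr
        exact hdist i
      rw [abs_le] at h1 h2 ⊢
      constructor <;> linarith [h1.1, h1.2, h2.1, h2.2]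
    have hσp : σ * ((δ + L * D i) / σ) = δ + L * D i := by field_simp
    have hp : 0 ≤ (δ + L * D i) / σ := by positivity
    have hs := h.step i hi
    have hg := hs.norm_gradient_add_le hf hL hA hσ.le hΔ hsymm hBi
    have hx := hs.xi_le hf hL hA hψ hψ2 hσ.le hΔ hBi
    have hd := hs.le_objective_sub hf hA hBi
    rw [← hσp] at hg hx hd
    have hqrp : q ≤ r i + (δ + L * D i) / σ :=
      sqrt_div_le_of_not_stationary hσ hP hm hLσ' hσP (hr0 i) hp (le_max_right _ _) hg hx
        (hnot i hi)
    exact (cubic_decrease_bound hLσ' hσ (hr0 i) hp (Real.sqrt_nonneg _) hqrp).trans hd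
  -- From `(a + b) ^ 3 ≤ 4 * (a ^ 3 + b ^ 3)`, with `4 / 65536 = 1 / 16384`.
  have hp3 : ∀ i, ((δ + L * D i) / σ) ^ 3 ≤ q ^ 3 / 16384 + 4 * (L / σ) ^ 3 * D i ^ 3 := by
    intro i
    have h1 : 0 ≤ δ / σ := by positivity
    have h2 : 0 ≤ L / σ * D i := by have := hD0 i; positivity
    have h3 := add_pow_le h1 h2 3
    have h4 : (δ + L * D i) / σ = δ / σ + L / σ * D i := by ring
    rw [h4]
    have h5 : (L / σ) ^ 3 * D i ^ 3 = (L / σ * D i) ^ 3 := by ring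
    norm_num at h3
    linarith
  have htm : ((t + 1 : ℕ) : ℝ) ≤ m := by exact_mod_cast (Nat.succ_le_of_lt ht).trans h.le_m
  set S := ∑ j ∈ Finset.range (t + 1), r j ^ 3 with hS
  have hS0 : 0 ≤ S := Finset.sum_nonneg fun j _ => pow_nonneg (hr0 j) 3
  have hsumD : ∑ i ∈ Finset.range (t + 1), D i ^ 3 ≤ (m : ℝ) ^ 3 / 3 * S :=
    (sum_pow_three_partial_sum_le hr0 (t + 1)).trans (by gcongr)
  have hLm : (L / σ) ^ 3 * (m : ℝ) ^ 3 ≤ 1 / 1728 := by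
    have h1 : L / σ * m ≤ 1 / 12 := by
      rw [div_mul_eq_mul_div, div_le_iff₀ hσ]
      linarith
    rw [← mul_pow]
    refine (pow_le_pow_left₀ (by positivity) h1 3).trans (by norm_num)
  have hLσ3 : 0 ≤ (L / σ) ^ 3 := by positivity
  have htot : σ * ∑ i ∈ Finset.range (t + 1),
      (q ^ 3 / 192 + r i ^ 3 / 24 - 128 / 3 * (q ^ 3 / 16384 + 4 * (L / σ) ^ 3 * D i ^ 3))
      ≤ objective f ψ (y 0) - objective f ψ (y (t + 1)) := by
    rw [← Finset.sum_range_sub' (fun i => objective f ψ (y i)), Finset.mul_sum]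
    refine Finset.sum_le_sum fun i hi => le_trans ?_ (hstep i ?_)
    · have := hp3 i
      gcongr
    · have := Finset.mem_range.1 hi
      omega
  rw [Progress, ← div_div, div_right_comm, ← mul_sqrt_div_pow_three hε.le hσ]
  refine le_trans ?_ htot
  simp only [Finset.sum_add_distrib, Finset.sum_sub_distrib, ← Finset.mul_sum, ← Finset.sum_div,
    Finset.sum_const, Finset.card_range, nsmul_eq_mul, mul_add]
  have h1 := mul_le_mul_of_nonneg_left hsumD hLσ3
  have h2 := mul_le_mul_of_nonneg_right hLm hS0
  -- Finite differences cost `128 / 3 / 16384 = 1 / 384` per step, half of `1 / 192`. The drift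
  -- costs at most `128 / 3 * 4 / (3 * 1728)` times `S`, which is below `S / 24`.
  have h3 : q ^ 3 / 384 * ((t : ℝ) + 1) ≤ ((t + 1 : ℕ) : ℝ) * (q ^ 3 / 192) + S / 24
      - (128 / 3 * (((t + 1 : ℕ) : ℝ) * (q ^ 3 / 16384)) + 128 / 3 *
        (4 * (L / σ) ^ 3 * ∑ i ∈ Finset.range (t + 1), D i ^ 3)) := by
    push_cast
    linarith
  have h4 := mul_le_mul_of_nonneg_left h3 hσ.le
  linarith

end Progress

/-! ### The parameters of the method -/

section Parameters

variable {n m : ℕ} {τ ε : ℝ} {l : ℕ}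

theorem sigmaParam_pos (hm : 1 ≤ m) (hτ : 0 < τ) : 0 < sigmaParam m τ l := by
  have : (0 : ℝ) < m := by exact_mod_cast hm
  unfold sigmaParam
  positivity

theorem twelve_mul_le_sigmaParam (hτ : 0 < τ) : 12 * (2 ^ l * τ * m) ≤ sigmaParam m τ l := by
  -- `(3 / 4) ^ 3 = 27 / 64 ≤ 2 / 3`, and `16 * 3 / 4 = 12`.
  have h1 : (3 / 4 : ℝ) ≤ (2 / 3 : ℝ) ^ (1 / 3 : ℝ) := by
    have h2 : (3 / 4 : ℝ) = ((3 / 4 : ℝ) ^ (3 : ℕ)) ^ (1 / 3 : ℝ) := by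
      rw [← Real.rpow_natCast, ← Real.rpow_mul (by norm_num)]
      norm_num
    rw [h2]
    gcongr
    norm_num
  have h3 : 0 ≤ 2 ^ l * τ * m := by positivity
  have h4 := mul_le_mul_of_nonneg_right h1 h3
  unfold sigmaParam
  linarith

theorem sigmaParam_le {P : ℝ} (h : 2 ^ l * τ ≤ 2 * P) :
    sigmaParam m τ l ≤ 32 * (2 / 3 : ℝ) ^ (1 / 3 : ℝ) * P * m := by
  have h1 : 2 ^ 4 * (2 / 3 : ℝ) ^ (1 / 3 : ℝ) * (2 ^ l * τ) * m
      ≤ 2 ^ 4 * (2 / 3 : ℝ) ^ (1 / 3 : ℝ) * (2 * P) * m := by gcongr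
  unfold sigmaParam
  linarith

theorem sigmaParam_le_mul {P : ℝ} (hP : 0 ≤ P) (h : 2 ^ l * τ ≤ 2 * P) :
    sigmaParam m τ l ≤ 32 * m * P := by
  have h1 : (2 / 3 : ℝ) ^ (1 / 3 : ℝ) ≤ 1 :=
    Real.rpow_le_one (by norm_num) (by norm_num) (by norm_num)
  have h2 : 32 * (2 / 3 : ℝ) ^ (1 / 3 : ℝ) * P * m ≤ 32 * 1 * P * m := by gcongr
  linarith [sigmaParam_le (m := m) h]

theorem sigmaParam_rpow_half_le {P : ℝ} (hm : 1 ≤ m) (hτ : 0 < τ) (hP : 0 ≤ P)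
    (h : 2 ^ l * τ ≤ 2 * P) : sigmaParam m τ l ^ (1 / 2 : ℝ)
      ≤ 2 ^ (5 / 2 : ℝ) * (2 / 3 : ℝ) ^ (1 / 6 : ℝ) * P ^ (1 / 2 : ℝ) * √m := by
  refine (Real.rpow_le_rpow (sigmaParam_pos hm hτ).le (sigmaParam_le h) (by norm_num)).trans
    (le_of_eq ?_)
  have h1 : (32 : ℝ) = 2 ^ (5 : ℝ) := by norm_num
  rw [Real.mul_rpow (by positivity) (by positivity), Real.mul_rpow (by positivity) hP,
    Real.mul_rpow (by norm_num) (by positivity), h1, ← Real.rpow_mul (by norm_num),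
    ← Real.rpow_mul (by norm_num), Real.sqrt_eq_rpow]
  norm_num

theorem hParam_pos (hn : n ≠ 0) (hm : 1 ≤ m) (hτ : 0 < τ) (hε : 0 < ε) :
    0 < hParam n m ε τ l := by
  have hn' : (0 : ℝ) < n := by positivity
  have hσ := sigmaParam_pos (l := l) hm hτ
  unfold hParam
  positivity

theorem hParam_nonneg (hm : 1 ≤ m) (hτ : 0 < τ) (hε : 0 < ε) : 0 ≤ hParam n m ε τ l := by
  have hσ := sigmaParam_pos (l := l) hm hτ
  unfold hParam
  positivity

/-- For `n ≠ 0` this is an equality, and `hParam` is designed to make it one; `2 ^ l * τ` stands in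
for the unknown `L`. -/
theorem fd_error_pow_three_le (hm : 1 ≤ m) (hτ : 0 < τ) (hε : 0 < ε) :
    65536 * (√n * (2 ^ l * τ) * hParam n m ε τ l / 2 / sigmaParam m τ l) ^ 3
      ≤ √(ε / sigmaParam m τ l) ^ 3 := by
  rcases eq_or_ne n 0 with rfl | hn
  · simp
  have hn' : (0 : ℝ) < n := by positivity
  have hσ := sigmaParam_pos (l := l) hm hτ
  have h1 : hParam n m ε τ l ^ 3 = 3 * √(sigmaParam m τ l) ^ 3 * √ε ^ 3 /
      (2 ^ 7 * 192 * √n ^ 3 * (2 ^ l * τ) ^ 3) := by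
    unfold hParam
    rw [← Real.rpow_natCast, ← Real.rpow_mul (by positivity), rpow_three_halves hσ.le,
      rpow_three_halves hε.le, rpow_three_halves hn'.le]
    norm_num
  set σ := sigmaParam m τ l
  have hs : 0 < √σ := Real.sqrt_pos.2 hσ
  have hsn : 0 < √(n : ℝ) := Real.sqrt_pos.2 hn'
  have h2 : σ ^ 3 = √σ ^ 6 := by
    rw [show √σ ^ 6 = (√σ ^ 2) ^ 3 by ring, Real.sq_sqrt hσ.le]
  rw [div_pow, div_pow, mul_pow, mul_pow, h1, h2, Real.sqrt_div hε.le, div_pow]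
  refine le_of_eq ?_
  field_simp
  norm_num

theorem abs_inner_act_fdHessian_hParam_sub_le {f : Vec n → ℝ} {L : ℝ} (hf : ContDiff ℝ 2 f)
    (hL : 0 ≤ L) (hA : LipschitzHessian f L) (hm : 1 ≤ m) (hτ : 0 < τ) (hε : 0 < ε)
    (hLτ : L ≤ 2 ^ l * τ) (x v w : Vec n) :
    |inner ℝ (act (fdHessian f x (hParam n m ε τ l)) v) w - fderiv ℝ (fderiv ℝ f) x v w|
      ≤ √n * (2 ^ l * τ) * hParam n m ε τ l / 2 * ‖v‖ * ‖w‖ := by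
  rcases eq_or_ne n 0 with rfl | hn
  · simp [Subsingleton.elim v 0, Subsingleton.elim w 0]
  have hh := hParam_pos (l := l) hn hm hτ hε
  refine (abs_inner_act_fdHessian_sub_le hf hL hA x hh v w).trans ?_
  gcongr

end Parameters

/-! ### Counting iterations -/

section Counting

variable {n m : ℕ} {f : Vec n → ℝ} {ψ : Vec n → EReal} {L τ₀ ε : ℝ} {x₀ : Vec n} {R : Trace n}

theorem FirstOrderCNM.progress (hf : ContDiff ℝ 2 f) (hL : 0 ≤ L) (hA : LipschitzHessian f L)
    (hψ : ProperClosedConvex ψ) (hψ2 : TwiceDifferentiable ψ) (hτ₀ : 0 < τ₀) (hε : 0 < ε)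
    (hm : 1 ≤ m) (hR : FirstOrderCNM f ψ x₀ τ₀ ε m R) {k l : ℕ} (hex : R.Executed k l)
    (hτ : 0 < R.τ k) (hlow : L ≤ 2 ^ l * R.τ k) (hup : 2 ^ l * R.τ k ≤ 2 * max τ₀ L)
    (hnot : ¬ SecondOrderFound f ψ L τ₀ ε m R k) {t : ℕ} (ht : t < R.N k l) :
    Progress f ψ (sigmaParam m (R.τ k) l) ε (R.y k l) t := by
  have hP : 0 < max τ₀ L := lt_max_of_lt_left hτ₀
  have hh := hParam_nonneg (n := n) (l := l) hm hτ hε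
  refine (hR.call k l hex).progress (P := max τ₀ L)
    (δ := √n * (2 ^ l * R.τ k) * hParam n m ε (R.τ k) l / 2) hf hL hA hψ hψ2 hε
    (sigmaParam_pos hm hτ) hP hm ?_ (sigmaParam_le_mul hP.le hup) (by positivity)
    (fd_error_pow_three_le hm hτ hε) (inner_act_fdHessian_comm f _ _)
    (abs_inner_act_fdHessian_hParam_sub_le hf hL hA hm hτ hε hlow _) ?_ ht
  · refine le_trans ?_ (twelve_mul_le_sigmaParam hτ)
    gcongr
  · intro i hi
    by_contra! hle
    exact hnot ⟨l, i + 1, hex, hi, hle⟩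

theorem CubicSteps.eq_success {B : Matrix (Fin n) (Fin n) ℝ} {σ : ℝ} {x : Vec n}
    {y s : ℕ → Vec n} {N : ℕ} {α : Status} (h : CubicSteps f ψ x B σ m ε y s N α)
    (hp : ∀ t < N, Progress f ψ σ ε y t) : α = Status.success := by
  rcases h.finished with h1 | h1
  · exact h1.1
  · exact absurd (hp (N - 1) (Nat.sub_lt h.one_le one_pos)) h1.2

theorem CubicSteps.mem_dom {B : Matrix (Fin n) (Fin n) ℝ} {σ : ℝ} {x : Vec n}
    {y s : ℕ → Vec n} {N : ℕ} {α : Status} (h : CubicSteps f ψ x B σ m ε y s N α) :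
    y N ∈ dom ψ := by
  have h1 := (h.step (N - 1) (Nat.sub_lt h.one_le one_pos)).mem
  rwa [Nat.sub_add_cancel h.one_le] at h1

theorem Status.eq_halt_of_ne_success {α : Status} (h : α ≠ Status.success) :
    α = Status.halt := by
  cases α
  · exact absurd rfl h
  · rfl

/-- Call `l + 1` is executed only if call `l` halted, which by `FirstOrderCNM.progress` requires `2
^ l * R.τ k < L`; one doubling then overshoots by at most a factor `2`. -/
theorem FirstOrderCNM.two_pow_mul_le (hf : ContDiff ℝ 2 f) (hL : 0 ≤ L)
    (hA : LipschitzHessian f L) (hψ : ProperClosedConvex ψ) (hψ2 : TwiceDifferentiable ψ)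
    (hτ₀ : 0 < τ₀) (hε : 0 < ε) (hm : 1 ≤ m) (hR : FirstOrderCNM f ψ x₀ τ₀ ε m R) {k : ℕ}
    (hτ : 0 < R.τ k) (hτP : R.τ k ≤ max τ₀ L) (hnot : ¬ SecondOrderFound f ψ L τ₀ ε m R k)
    (l : ℕ) (hex : R.Executed k l) : 2 ^ l * R.τ k ≤ 2 * max τ₀ L := by
  induction l with
  | zero =>
    rw [pow_zero, one_mul]
    linarith
  | succ l ih =>
    have hexl : R.Executed k l := ⟨hex.1, fun i hi => hex.2 i (hi.trans l.lt_succ_self)⟩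
    have hup := ih hexl
    have hlt : 2 ^ l * R.τ k < L := by
      by_contra! hlow
      have h1 := (hR.call k l hexl).eq_success fun t ht =>
        hR.progress hf hL hA hψ hψ2 hτ₀ hε hm hexl hτ hlow hup hnot ht
      rw [hex.2 l l.lt_succ_self] at h1
      cases h1
    rw [pow_succ]
    linarith [le_max_right τ₀ L]

theorem FirstOrderCNM.exists_success (hf : ContDiff ℝ 2 f) (hL : 0 ≤ L)
    (hA : LipschitzHessian f L) (hψ : ProperClosedConvex ψ) (hψ2 : TwiceDifferentiable ψ)
    (hτ₀ : 0 < τ₀) (hε : 0 < ε) (hm : 1 ≤ m) (hR : FirstOrderCNM f ψ x₀ τ₀ ε m R) {k : ℕ}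
    (hprev : ∀ j < k, ∃ i, R.α j i = Status.success)
    (hτ : 0 < R.τ k) (hτP : R.τ k ≤ max τ₀ L) (hnot : ¬ SecondOrderFound f ψ L τ₀ ε m R k) :
    ∃ l, R.α k l = Status.success := by
  by_contra! hno
  obtain ⟨l, hl⟩ := pow_unbounded_of_one_lt (2 * max τ₀ L / R.τ k) (one_lt_two (α := ℝ))
  rw [div_lt_iff₀ hτ] at hl
  exact hl.not_ge (hR.two_pow_mul_le hf hL hA hψ hψ2 hτ₀ hε hm hτ hτP hnot l
    ⟨hprev, fun i _ => Status.eq_halt_of_ne_success (hno i)⟩)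

theorem Trace.success_lastCall {k : ℕ} (h : ∃ l, R.α k l = Status.success) :
    R.α k (R.lastCall k) = Status.success :=
  Nat.sInf_mem (s := {l | R.α k l = Status.success}) h

theorem Trace.executed_of_le_lastCall {k l : ℕ}
    (hprev : ∀ j < k, ∃ i, R.α j i = Status.success) (hl : l ≤ R.lastCall k) :
    R.Executed k l :=
  ⟨hprev, fun _ hi => Status.eq_halt_of_ne_success fun hs =>
    Nat.notMem_of_lt_sInf (hi.trans_le hl) hs⟩

theorem FirstOrderCNM.sum_calls_le (hR : FirstOrderCNM f ψ x₀ τ₀ ε m R) {k : ℕ}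
    (hprev : ∀ j < k, ∃ i, R.α j i = Status.success) :
    ∑ l ∈ Finset.range (R.lastCall k + 1), ((n + 1) + (R.N k l + 1))
      ≤ (R.lastCall k + 1) * (n + m + 2) := by
  have h := Finset.sum_le_card_nsmul (Finset.range (R.lastCall k + 1))
    (fun l => (n + 1) + (R.N k l + 1)) (n + m + 2) fun l hl => by
      have h1 := (hR.call k l (Trace.executed_of_le_lastCall hprev
        (Nat.lt_succ_iff.1 (Finset.mem_range.1 hl)))).le_m
      omega
  simpa using h

/-- The claims are proved together: the bounds on `R.τ k` give termination of the search at
iteration `k`, which in turn gives the next point, the next `τ` and the cost. -/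
theorem FirstOrderCNM.invariant (hf : ContDiff ℝ 2 f) (hL : 0 ≤ L)
    (hA : LipschitzHessian f L) (hψ : ProperClosedConvex ψ) (hψ2 : TwiceDifferentiable ψ)
    (hx₀ : x₀ ∈ dom ψ) (hτ₀ : 0 < τ₀) (hε : 0 < ε) (hm : 1 ≤ m)
    (hR : FirstOrderCNM f ψ x₀ τ₀ ε m R) (T : ℕ)
    (hnot : ∀ k < T, ¬ SecondOrderFound f ψ L τ₀ ε m R k) :
    (∀ j < T, ∃ i, R.α j i = Status.success) ∧ τ₀ ≤ R.τ T ∧ R.τ T ≤ max τ₀ L ∧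
      R.x T ∈ dom ψ ∧
      T * (ε ^ (3 / 2 : ℝ) * √m / (384 * (2 ^ (5 / 2 : ℝ) * (2 / 3 : ℝ) ^ (1 / 6 : ℝ) *
        (max τ₀ L) ^ (1 / 2 : ℝ)))) ≤ objective f ψ x₀ - objective f ψ (R.x T) ∧
      (R.oracleCalls T : ℝ) ≤ (5 + 2 * ((n : ℝ) + m)) * T
        + (2 + (n : ℝ) + m) * Real.logb 2 (R.τ T / τ₀) := by
  have hP : 0 < max τ₀ L := lt_max_of_lt_left hτ₀
  have hm0 : (0 : ℝ) < m := by exact_mod_cast hm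
  induction T with
  | zero => simp [hR.τ_zero, hR.x_zero, hx₀, Trace.oracleCalls, hτ₀.ne']
  | succ k ih =>
    obtain ⟨hprev, hτlow, hτup, -, hdec, hcalls⟩ := ih fun j hj => hnot j (hj.trans k.lt_succ_self)
    have hτ : 0 < R.τ k := hτ₀.trans_le hτlow
    have hnk := hnot k k.lt_succ_self
    have hsucc := hR.exists_success hf hL hA hψ hψ2 hτ₀ hε hm hprev hτ hτup hnk
    have hα := Trace.success_lastCall hsucc
    have hex : R.Executed k (R.lastCall k) := Trace.executed_of_le_lastCall hprev le_rfl
    have hpow := hR.two_pow_mul_le hf hL hA hψ hψ2 hτ₀ hε hm hτ hτup hnk _ hex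
    have hcall := hR.call k _ hex
    have hxs := hR.x_succ k _ hex hα
    have hτs := hR.τ_succ k _ hex hα
    have hsum := hR.sum_calls_le hprev
    set l := R.lastCall k with hl
    have hzpow : (2 : ℝ) ^ ((l : ℤ) - 1) = 2 ^ l / 2 := by
      rw [zpow_sub_one₀ two_ne_zero, zpow_natCast, div_eq_mul_inv]
    rw [hzpow] at hτs
    have hτs0 : τ₀ ≤ R.τ (k + 1) := hτs ▸ le_max_left _ _
    refine ⟨?_, hτs0, ?_, hxs ▸ hcall.mem_dom, ?_, ?_⟩
    · intro j hj
      rcases Nat.lt_succ_iff_lt_or_eq.1 hj with h | rfl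
      · exact hprev j h
      · exact hsucc
    · rw [hτs]
      exact max_le (le_max_left _ _) (by linarith)
    · rcases hcall.finished with ⟨-, hN, hprog⟩ | ⟨hhalt, -⟩
      -- On success `N = m`, so the last test, with index `m - 1`, measures the decrease over the
      -- whole run and carries the factor `m`.
      · rw [Progress, Nat.sub_add_cancel hcall.one_le, ← hxs, hcall.start, hN, Nat.cast_sub hm,
          Nat.cast_one, sub_add_cancel] at hprog
        have hσ := sigmaParam_rpow_half_le hm hτ hP.le hpow
        set K := 2 ^ (5 / 2 : ℝ) * (2 / 3 : ℝ) ^ (1 / 6 : ℝ) * (max τ₀ L) ^ (1 / 2 : ℝ)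
        have hK : 0 < K := by positivity
        have hσ0 := sigmaParam_pos (l := l) hm hτ
        have h1 : ε ^ (3 / 2 : ℝ) * √m / (384 * K) = ε ^ (3 / 2 : ℝ) / (384 * (K * √m)) * m := by
          have h2 : 0 < √(m : ℝ) := Real.sqrt_pos.2 hm0
          nth_rw 3 [← Real.sq_sqrt hm0.le]
          field_simp
        have h3 : ε ^ (3 / 2 : ℝ) / (384 * (K * √m)) * m
            ≤ ε ^ (3 / 2 : ℝ) / (384 * sigmaParam m (R.τ k) l ^ (1 / 2 : ℝ)) * m := by
          gcongr
        rw [h1] at hdec ⊢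
        push_cast
        linarith
      · rw [hα] at hhalt
        cases hhalt
    · have h1 : R.oracleCalls (k + 1) ≤ R.oracleCalls k + (1 + (l + 1) * (n + m + 2)) := by
        rw [Trace.oracleCalls, Finset.sum_range_succ]
        exact Nat.add_le_add_left (Nat.add_le_add_left hsum 1) _
      have h2 : (R.oracleCalls (k + 1) : ℝ)
          ≤ R.oracleCalls k + (1 + (l + 1) * ((n : ℝ) + m + 2)) := by exact_mod_cast h1
      -- The update of `τ` gives `2 ^ l * τ k ≤ 2 * τ (k + 1)`, so `l + 1` is at most `2` plus the
      -- increase of `log₂ τ`. The cost per iteration is then `1 + 2 * (n + m + 2) = 5 + 2 * (n +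
      -- m)` plus a telescoping term.
      have h3 : (l : ℝ) + Real.logb 2 (R.τ k / τ₀) ≤ 1 + Real.logb 2 (R.τ (k + 1) / τ₀) := by
        have h4 : (l : ℝ) + Real.logb 2 (R.τ k / τ₀) = Real.logb 2 (2 ^ l * (R.τ k / τ₀)) := by
          rw [Real.logb_mul (by positivity) (by positivity), Real.logb_pow,
            Real.logb_self_eq_one one_lt_two, mul_one]
        have hτs1 : 0 < R.τ (k + 1) := hτ₀.trans_le hτs0
        have h5 : 1 + Real.logb 2 (R.τ (k + 1) / τ₀) = Real.logb 2 (2 * (R.τ (k + 1) / τ₀)) := by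
          rw [Real.logb_mul (by positivity) (by positivity), Real.logb_self_eq_one one_lt_two]
        rw [h4, h5]
        refine Real.logb_le_logb_of_le one_lt_two (by positivity) ?_
        have h6 : 2 ^ l / 2 * R.τ k ≤ R.τ (k + 1) := hτs ▸ le_max_right _ _
        rw [← mul_div_assoc, ← mul_div_assoc]
        exact div_le_div_of_nonneg_right (by linarith) hτ₀.le
      have h7 := mul_le_mul_of_nonneg_left h3 (show 0 ≤ 2 + (n : ℝ) + m by positivity)
      push_cast
      linarith

end Counting

end CNM

/-! ### The complexity bounds -/

theorem mainTheorem4 {n : ℕ} (f : CNM.Vec n → ℝ) (ψ : CNM.Vec n → EReal) (L : ℝ)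
    (hf : ContDiff ℝ 2 f) (hL : 0 ≤ L) (hA1 : CNM.LipschitzHessian f L)
    (hψ : CNM.ProperClosedConvex ψ) (hψ2 : CNM.TwiceDifferentiable ψ)
    (hbdd : BddBelow (CNM.objective f ψ '' CNM.dom ψ))
    (x₀ : CNM.Vec n) (hx₀ : x₀ ∈ CNM.dom ψ)
    (τ₀ ε : ℝ) (hτ₀ : 0 < τ₀) (hε : 0 < ε) (m : ℕ) (hm : 1 ≤ m)
    (R : CNM.Trace n) (hR : CNM.FirstOrderCNM f ψ x₀ τ₀ ε m R) :
    ∃ T : ℕ, IsLeast {k | CNM.SecondOrderFound f ψ L τ₀ ε m R k} T ∧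
      (T : ℝ) ≤ 384 * 2 ^ (5 / 2 : ℝ) * (2 / 3 : ℝ) ^ (1 / 6 : ℝ) * (max τ₀ L) ^ (1 / 2 : ℝ) *
          (CNM.objective f ψ x₀ - CNM.optimalValue f ψ) / Real.sqrt m * ε ^ (-(3 / 2) : ℝ) ∧
      (R.oracleCalls T : ℝ) ≤
        (5 + 2 * ((n : ℝ) + m)) / Real.sqrt m * 384 * 2 ^ (5 / 2 : ℝ) * (2 / 3 : ℝ) ^ (1 / 6 : ℝ) *
            (max τ₀ L) ^ (1 / 2 : ℝ) *
            (CNM.objective f ψ x₀ - CNM.optimalValue f ψ) * ε ^ (-(3 / 2) : ℝ)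
          + (2 + (n : ℝ) + m) * Real.logb 2 (max τ₀ L / τ₀) := by
  have hP : 0 < max τ₀ L := lt_max_of_lt_left hτ₀
  have hm0 : (0 : ℝ) < √m := Real.sqrt_pos.2 (by exact_mod_cast hm)
  set C := 384 * 2 ^ (5 / 2 : ℝ) * (2 / 3 : ℝ) ^ (1 / 6 : ℝ) * (max τ₀ L) ^ (1 / 2 : ℝ) *
    (CNM.objective f ψ x₀ - CNM.optimalValue f ψ) / Real.sqrt m * ε ^ (-(3 / 2) : ℝ) with hC
  have hbound : ∀ T : ℕ, (∀ k < T, ¬ CNM.SecondOrderFound f ψ L τ₀ ε m R k) → (T : ℝ) ≤ C := by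
    intro T hT
    obtain ⟨-, -, -, hx, hdec, -⟩ :=
      hR.invariant hf hL hA1 hψ hψ2 hx₀ hτ₀ hε hm T hT
    have hopt : CNM.optimalValue f ψ ≤ CNM.objective f ψ (R.x T) :=
      csInf_le hbdd ⟨_, hx, rfl⟩
    have h1 := hdec.trans (sub_le_sub_left hopt _)
    rw [← le_div_iff₀ (by positivity)] at h1
    refine h1.trans (le_of_eq ?_)
    rw [hC, Real.rpow_neg hε.le]
    field_simp
  -- Without a stationary iterate the bound `C` would hold for every `T`.
  have hex : ∃ k, CNM.SecondOrderFound f ψ L τ₀ ε m R k := by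
    by_contra! hno
    obtain ⟨T, hT⟩ := exists_nat_gt C
    exact hT.not_ge (hbound T fun k _ => hno k)
  classical
  have hmin : ∀ k < Nat.find hex, ¬ CNM.SecondOrderFound f ψ L τ₀ ε m R k :=
    fun k hk => Nat.find_min hex hk
  have hT := hbound _ hmin
  refine ⟨Nat.find hex, ⟨Nat.find_spec hex, fun k hk => Nat.find_min' hex hk⟩, hT, ?_⟩
  obtain ⟨-, hτlow, hτup, -, -, hcalls⟩ :=
    hR.invariant hf hL hA1 hψ hψ2 hx₀ hτ₀ hε hm _ hmin
  have h1 : Real.logb 2 (R.τ (Nat.find hex) / τ₀) ≤ Real.logb 2 (max τ₀ L / τ₀) :=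
    Real.logb_le_logb_of_le one_lt_two (div_pos (hτ₀.trans_le hτlow) hτ₀) (by gcongr)
  have h2 : (5 + 2 * ((n : ℝ) + m)) / √m * 384 * 2 ^ (5 / 2 : ℝ) * (2 / 3 : ℝ) ^ (1 / 6 : ℝ) *
      (max τ₀ L) ^ (1 / 2 : ℝ) * (CNM.objective f ψ x₀ - CNM.optimalValue f ψ) *
      ε ^ (-(3 / 2) : ℝ) = (5 + 2 * ((n : ℝ) + m)) * C := by
    rw [hC]
    ring
  rw [h2]
  refine hcalls.trans ?_
  gcongr
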